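/- Let $n\ge 2$ and let $\mathbb T^n=(\mathbb R/\mathbb Z)^n$ be the $n$-dimensional real torus, written additively. Let $\mathcal F$ be one of the following smoothness classes: $C^k$ with $k\in\{0,1,\dots,\infty\}$; locally Hölder $C^{k,\alpha}$ with $k\in\{0,1,\dots\}$ and $0\le\alpha\le1$ (where $C^{k,0}=C^k$); or locally Sobolev $W^{k,p}$ with $k\ge1$ an integer and $1\le p<\infty$ such that either $kp>n$, or $k=n$ and $p=1$. Let $\mathcal F(\mathbb T^n,\mathbb T^n)$ be the group, under pointwise addition, of all continuous maps $\mathbb T^n\to\mathbb T^n$ of class $\mathcal F$, with its usual Lie group topology: the group topology in which a basis of neighbourhoods of $0$ is given by the sets of maps $\exp\circ\, y$, where $\exp:\mathbb R^n\to\mathbb T^n$ is the canonical projection and $y:\mathbb T^n\to\mathbb R^n$ is of class $\mathcal F$ and small in the $\mathcal F$-norm (for $C^\infty$: in finitely many of the $C^j$-norms). Let $\pi_0(\mathcal F(\mathbb T^n,\mathbb T^n))$ be its group of connected components, that is, the quotient by the connected component of $0$, and let $[x]$ denote the class of $x$ in it. Then: 1. The group $\pi_0(\mathcal F(\mathbb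 T^n,\mathbb T^n))$ is isomorphic to the additive group $M_n(\mathbb Z)$ of $n\times n$ integer matrices. 2. The group $\pi_0(\mathcal F(\mathbb T^n,\mathbb T^n))$ is generated by the subset $\{[x_0] : x_0\in\mathcal F(\mathbb T^n,\mathbb T^n),\ x_0(\mathbb T^n)\ne\mathbb T^n\}$. 3. If $f:\mathcal F(\mathbb T^n,\mathbb T^n)\to\mathbb T^n$ is a group homomorphism (not assumed continuous) that is range decreasing, i.e. $f(x)\in x(\mathbb T^n)$ for every $x\in\mathcal F(\mathbb T^n,\mathbb T^n)$, then there is a point $v_0\in\mathbb T^n$ such that $f(x)=x(v_0)$ for every $x\in\mathcal F(\mathbb T^n,\mathbb T^n)$. -/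

import Mathlib

open Set MeasureTheory Filter Topology

namespace TorusMaps

/-- The covering homomorphism `ℝⁿ → 𝕋ⁿ = (ℝ/ℤ)ⁿ`, which is also the exponential map of the Lie
group `𝕋ⁿ`. -/
def proj (n : ℕ) (u : Fin n → ℝ) : UnitAddTorus (Fin n) := fun i => (u i : UnitAddCircle)

/-- `L^p_loc(ℝⁿ, ℝⁿ)`. -/
def MemLpLoc {n : ℕ} (p : ℝ) (X : (Fin n → ℝ) → Fin n → ℝ) : Prop :=
  ∀ K : Set (Fin n → ℝ), IsCompact K → MemLp X (ENNReal.ofReal p) (volume.restrict K)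

/-- `g` is the weak partial derivative `∂ᵢ X` on `ℝⁿ` (for locally integrable `X` and `g`). -/
def HasWeakPartial {n : ℕ} (i : Fin n) (X g : (Fin n → ℝ) → Fin n → ℝ) : Prop :=
  ∀ φ : (Fin n → ℝ) → ℝ, ContDiff ℝ ((⊤ : ℕ∞) : WithTop ℕ∞) φ → HasCompactSupport φ →
    ∫ u, φ u • g u = - ∫ u, (fderiv ℝ φ u (Pi.single i 1)) • X u

/-- `W^{k,p}_loc(ℝⁿ, ℝⁿ)`. -/
def MemSobolevLoc {n : ℕ} (p : ℝ) : ℕ → ((Fin n → ℝ) → Fin n → ℝ) → Prop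
  | 0, X => MemLpLoc p X
  | k + 1, X => MemLpLoc p X ∧ ∀ i, ∃ g, HasWeakPartial i X g ∧ MemSobolevLoc p k g

/-- `X ∈ W^{k,p}_loc(ℝⁿ, ℝⁿ)`, and the iterated weak partial derivatives of `X` of all orders `≤ k`
(order zero included) have `L^p` norm smaller than `ε` over the unit cube. -/
def SobolevLt {n : ℕ} (p ε : ℝ) : ℕ → ((Fin n → ℝ) → Fin n → ℝ) → Prop
  | 0, X => MemLpLoc p X ∧
      eLpNorm X (ENNReal.ofReal p) (volume.restrict (Icc 0 1)) < ENNReal.ofReal ε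
  | k + 1, X => (MemLpLoc p X ∧
      eLpNorm X (ENNReal.ofReal p) (volume.restrict (Icc 0 1)) < ENNReal.ofReal ε) ∧
      ∀ i, ∃ g, HasWeakPartial i X g ∧ SobolevLt p ε k g

/-- The smoothness classes on an `n`-dimensional manifold: `C^k` for `0 ≤ k ≤ ∞`, locally Hölder
`C^{k,α}` for `0 ≤ α ≤ 1`, and locally Sobolev `W^{k,p}` for `k ≥ 1`, `1 ≤ p < ∞` with
`k p > n`, or `k = n` and `p = 1`. -/
inductive SmoothnessClass (n : ℕ) : Type
  | contDiff (k : ℕ∞) : SmoothnessClass n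
  | holder (k : ℕ) (α : NNReal) (hα : α ≤ 1) : SmoothnessClass n
  | sobolev (k : ℕ) (p : ℝ) (hk : 1 ≤ k) (hp : 1 ≤ p)
      (hkp : (n : ℝ) < k * p ∨ (k = n ∧ p = 1)) : SmoothnessClass n

namespace SmoothnessClass

variable {n : ℕ}

/-- The map `X : ℝⁿ → ℝⁿ` is locally of class `F`. -/
def MemLoc : SmoothnessClass n → ((Fin n → ℝ) → Fin n → ℝ) → Prop
  | contDiff k, X => ContDiff ℝ (k : WithTop ℕ∞) X
  | holder k α _, X => ContDiff ℝ (k : WithTop ℕ∞) X ∧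
      ∀ u, ∃ U ∈ 𝓝 u, ∃ C : NNReal, HolderOnWith C α (iteratedFDeriv ℝ k X) U
  | sobolev k p _ _ _, X => MemSobolevLoc p k X

/-- The continuous map `x : 𝕋ⁿ → 𝕋ⁿ` is of class `F`: its continuous lift to the universal covers
`ℝⁿ → ℝⁿ` (which is `x` read in the standard charts of `𝕋ⁿ`, the local inverses of
`proj n`) is locally of class `F`. -/
def Contains (F : SmoothnessClass n) (x : C(UnitAddTorus (Fin n), UnitAddTorus (Fin n))) : Prop :=
  ∃ X : (Fin n → ℝ) → Fin n → ℝ,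
    Continuous X ∧ (∀ u, proj n (X u) = x (proj n u)) ∧ F.MemLoc X

/-- `Y` is smaller than `ε` in the norm of the class `F` for periodic functions: the `C^{min(j,k)}`
norm for `C^k`, the `C^{k,α}` norm for Hölder classes, the `W^{k,p}` norm for Sobolev classes. -/
def Small (j : ℕ) (ε : ℝ) : SmoothnessClass n → ((Fin n → ℝ) → Fin n → ℝ) → Prop
  | contDiff k, Y => ∀ i : ℕ, i ≤ j → (i : ℕ∞) ≤ k → ∀ u, ‖iteratedFDeriv ℝ i Y u‖ < ε
  | holder k α _, Y => (∀ i : ℕ, i ≤ k → ∀ u, ‖iteratedFDeriv ℝ i Y u‖ < ε) ∧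
      ∀ u w, ‖iteratedFDeriv ℝ k Y u - iteratedFDeriv ℝ k Y w‖ ≤ ε * ‖u - w‖ ^ (α : ℝ)
  | sobolev k p _ _ _, Y => SobolevLt p ε k Y

end SmoothnessClass

section Helpers

variable {n : ℕ}

theorem proj_add (u v : Fin n → ℝ) : proj n (u + v) = proj n u + proj n v := by
  ext i; simp [proj]

theorem proj_neg (u : Fin n → ℝ) : proj n (-u) = -proj n u := by
  ext i; simp [proj]

theorem proj_zero : proj n 0 = 0 := by
  ext i; simp [proj]

theorem continuous_proj : Continuous (proj n) :=
  continuous_pi fun i => (AddCircle.continuous_mk' (1 : ℝ)).comp (continuous_apply i)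

theorem MemLpLoc.zero (p : ℝ) : MemLpLoc p (0 : (Fin n → ℝ) → Fin n → ℝ) :=
  fun _ _ => MemLp.zero

theorem MemLpLoc.add {p : ℝ} {X Y : (Fin n → ℝ) → Fin n → ℝ} (hX : MemLpLoc p X)
    (hY : MemLpLoc p Y) : MemLpLoc p (X + Y) :=
  fun K hK => (hX K hK).add (hY K hK)

theorem MemLpLoc.neg {p : ℝ} {X : (Fin n → ℝ) → Fin n → ℝ} (hX : MemLpLoc p X) :
    MemLpLoc p (-X) :=
  fun K hK => (hX K hK).neg

theorem MemLpLoc.locallyIntegrable {p : ℝ} (hp : 1 ≤ p) {X : (Fin n → ℝ) → Fin n → ℝ}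
    (hX : MemLpLoc p X) : LocallyIntegrable X := by
  rw [locallyIntegrable_iff]
  intro K hK
  have : IsFiniteMeasure (volume.restrict K) := ⟨by simpa using hK.measure_lt_top⟩
  exact (hX K hK).integrable (by simpa using ENNReal.ofReal_le_ofReal hp)

theorem HasWeakPartial.zero (i : Fin n) :
    HasWeakPartial i (0 : (Fin n → ℝ) → Fin n → ℝ) 0 := by
  intro φ _ _; simp

theorem HasWeakPartial.neg {i : Fin n} {X g : (Fin n → ℝ) → Fin n → ℝ}
    (h : HasWeakPartial i X g) : HasWeakPartial i (-X) (-g) := by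
  intro φ h1 h2
  simp only [Pi.neg_apply, smul_neg, integral_neg, h φ h1 h2]

theorem HasWeakPartial.add {i : Fin n} {X g Y l : (Fin n → ℝ) → Fin n → ℝ}
    (hX : LocallyIntegrable X) (hg : LocallyIntegrable g)
    (hY : LocallyIntegrable Y) (hl : LocallyIntegrable l)
    (h : HasWeakPartial i X g) (h' : HasWeakPartial i Y l) :
    HasWeakPartial i (X + Y) (g + l) := by
  intro φ h1 h2
  have hc : Continuous fun u => fderiv ℝ φ u (Pi.single i 1) :=
    (h1.continuous_fderiv (by simp)).clm_apply continuous_const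
  have hs : HasCompactSupport fun u => fderiv ℝ φ u (Pi.single i 1) :=
    h2.fderiv_apply ℝ (Pi.single i 1)
  simp only [Pi.add_apply, smul_add]
  rw [integral_add (hg.integrable_smul_left_of_hasCompactSupport h1.continuous h2)
      (hl.integrable_smul_left_of_hasCompactSupport h1.continuous h2),
    integral_add (hX.integrable_smul_left_of_hasCompactSupport hc hs)
      (hY.integrable_smul_left_of_hasCompactSupport hc hs), h φ h1 h2, h' φ h1 h2, neg_add]

theorem MemSobolevLoc.memLpLoc {p : ℝ} {k : ℕ} {X : (Fin n → ℝ) → Fin n → ℝ}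
    (h : MemSobolevLoc p k X) : MemLpLoc p X := by
  cases k with
  | zero => exact h
  | succ k => exact h.1

theorem MemSobolevLoc.zero (p : ℝ) (k : ℕ) :
    MemSobolevLoc p k (0 : (Fin n → ℝ) → Fin n → ℝ) := by
  induction k with
  | zero => exact MemLpLoc.zero p
  | succ k ih => exact ⟨MemLpLoc.zero p, fun i => ⟨0, HasWeakPartial.zero i, ih⟩⟩

theorem MemSobolevLoc.neg {p : ℝ} {k : ℕ} {X : (Fin n → ℝ) → Fin n → ℝ}
    (h : MemSobolevLoc p k X) : MemSobolevLoc p k (-X) := by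
  induction k generalizing X with
  | zero => exact MemLpLoc.neg h
  | succ k ih =>
    refine ⟨h.1.neg, fun i => ?_⟩
    obtain ⟨g, hg, hg'⟩ := h.2 i
    exact ⟨-g, hg.neg, ih hg'⟩

theorem MemSobolevLoc.add {p : ℝ} (hp : 1 ≤ p) {k : ℕ} {X Y : (Fin n → ℝ) → Fin n → ℝ}
    (h : MemSobolevLoc p k X) (h' : MemSobolevLoc p k Y) : MemSobolevLoc p k (X + Y) := by
  induction k generalizing X Y with
  | zero => exact MemLpLoc.add h h'
  | succ k ih =>
    refine ⟨h.1.add h'.1, fun i => ?_⟩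
    obtain ⟨g, hg, hg'⟩ := h.2 i
    obtain ⟨l, hl, hl'⟩ := h'.2 i
    exact ⟨g + l, HasWeakPartial.add (h.1.locallyIntegrable hp)
      (hg'.memLpLoc.locallyIntegrable hp) (h'.1.locallyIntegrable hp)
      (hl'.memLpLoc.locallyIntegrable hp) hg hl, ih hg' hl'⟩

theorem SobolevLt.bound {p ε : ℝ} {k : ℕ} {X : (Fin n → ℝ) → Fin n → ℝ}
    (h : SobolevLt p ε k X) : MemLpLoc p X ∧
      eLpNorm X (ENNReal.ofReal p) (volume.restrict (Icc 0 1)) < ENNReal.ofReal ε := by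
  cases k with
  | zero => exact h
  | succ k => exact h.1

theorem sobolevLt_bound_zero (p : ℝ) {ε : ℝ} (hε : 0 < ε) :
    MemLpLoc p (0 : (Fin n → ℝ) → Fin n → ℝ) ∧
      eLpNorm (0 : (Fin n → ℝ) → Fin n → ℝ) (ENNReal.ofReal p) (volume.restrict (Icc 0 1))
        < ENNReal.ofReal ε :=
  ⟨MemLpLoc.zero p, by simpa using hε⟩

theorem SobolevLt.zero (p : ℝ) {ε : ℝ} (hε : 0 < ε) (k : ℕ) :
    SobolevLt p ε k (0 : (Fin n → ℝ) → Fin n → ℝ) := by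
  induction k with
  | zero => exact sobolevLt_bound_zero p hε
  | succ k ih => exact ⟨sobolevLt_bound_zero p hε, fun i => ⟨0, HasWeakPartial.zero i, ih⟩⟩

theorem SobolevLt.mono {p ε δ : ℝ} (hε : ε ≤ δ) {k : ℕ} {X : (Fin n → ℝ) → Fin n → ℝ}
    (h : SobolevLt p ε k X) : SobolevLt p δ k X := by
  have key : ∀ {Z : (Fin n → ℝ) → Fin n → ℝ}, (MemLpLoc p Z ∧
      eLpNorm Z (ENNReal.ofReal p) (volume.restrict (Icc 0 1)) < ENNReal.ofReal ε) →
      (MemLpLoc p Z ∧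
      eLpNorm Z (ENNReal.ofReal p) (volume.restrict (Icc 0 1)) < ENNReal.ofReal δ) :=
    fun h => ⟨h.1, h.2.trans_le (ENNReal.ofReal_le_ofReal hε)⟩
  induction k generalizing X with
  | zero => exact key h
  | succ k ih =>
    refine ⟨key h.1, fun i => ?_⟩
    obtain ⟨g, hg, hg'⟩ := h.2 i
    exact ⟨g, hg, ih hg'⟩

theorem SobolevLt.neg {p ε : ℝ} {k : ℕ} {X : (Fin n → ℝ) → Fin n → ℝ}
    (h : SobolevLt p ε k X) : SobolevLt p ε k (-X) := by
  induction k generalizing X with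
  | zero => exact ⟨h.1.neg, by rw [eLpNorm_neg]; exact h.2⟩
  | succ k ih =>
    refine ⟨⟨h.1.1.neg, by rw [eLpNorm_neg]; exact h.1.2⟩, fun i => ?_⟩
    obtain ⟨g, hg, hg'⟩ := h.2 i
    exact ⟨-g, hg.neg, ih hg'⟩

theorem SobolevLt.add {p ε δ : ℝ} (hp : 1 ≤ p) (hε : 0 ≤ ε) (hδ : 0 ≤ δ) {k : ℕ}
    {X Y : (Fin n → ℝ) → Fin n → ℝ}
    (h : SobolevLt p ε k X) (h' : SobolevLt p δ k Y) : SobolevLt p (ε + δ) k (X + Y) := by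
  have key : ∀ {Z W : (Fin n → ℝ) → Fin n → ℝ}, (MemLpLoc p Z ∧
      eLpNorm Z (ENNReal.ofReal p) (volume.restrict (Icc 0 1)) < ENNReal.ofReal ε) →
      (MemLpLoc p W ∧
      eLpNorm W (ENNReal.ofReal p) (volume.restrict (Icc 0 1)) < ENNReal.ofReal δ) →
      (MemLpLoc p (Z + W) ∧
      eLpNorm (Z + W) (ENNReal.ofReal p) (volume.restrict (Icc 0 1))
        < ENNReal.ofReal (ε + δ)) := by
    intro Z W hZ hW
    refine ⟨hZ.1.add hW.1, ?_⟩
    rw [ENNReal.ofReal_add hε hδ]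
    exact (eLpNorm_add_le (hZ.1 _ isCompact_Icc).1 (hW.1 _ isCompact_Icc).1
      (by simpa using ENNReal.ofReal_le_ofReal hp)).trans_lt (ENNReal.add_lt_add hZ.2 hW.2)
  induction k generalizing X Y with
  | zero => exact key h h'
  | succ k ih =>
    refine ⟨key h.1 h'.1, fun i => ?_⟩
    obtain ⟨g, hg, hg'⟩ := h.2 i
    obtain ⟨l, hl, hl'⟩ := h'.2 i
    exact ⟨g + l, HasWeakPartial.add (h.1.1.locallyIntegrable hp)
      (hg'.bound.1.locallyIntegrable hp) (h'.1.1.locallyIntegrable hp)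
      (hl'.bound.1.locallyIntegrable hp) hg hl, ih hg' hl'⟩

namespace SmoothnessClass

theorem memLoc_zero (F : SmoothnessClass n) : F.MemLoc 0 := by
  cases F with
  | contDiff k =>
    have h : ContDiff ℝ (k : WithTop ℕ∞) (0 : (Fin n → ℝ) → Fin n → ℝ) := contDiff_const
    exact h
  | holder k α _ =>
    refine ⟨contDiff_const, fun u => ⟨univ, univ_mem, 0, ?_⟩⟩
    rw [iteratedFDeriv_zero]
    intro a _ b _
    simp
  | sobolev k p _ _ _ => exact MemSobolevLoc.zero p k

theorem memLoc_neg (F : SmoothnessClass n) {X : (Fin n → ℝ) → Fin n → ℝ} (h : F.MemLoc X) :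
    F.MemLoc (-X) := by
  cases F with
  | contDiff k =>
    have h1 : ContDiff ℝ (k : WithTop ℕ∞) X := h
    exact h1.neg
  | holder k α _ =>
    refine ⟨ContDiff.neg h.1, fun u => ?_⟩
    obtain ⟨U, hU, C, hC⟩ := h.2 u
    refine ⟨U, hU, C, fun a ha b hb => ?_⟩
    rw [iteratedFDeriv_neg_apply, iteratedFDeriv_neg_apply, edist_neg_neg]
    exact hC a ha b hb
  | sobolev k p _ _ _ => exact MemSobolevLoc.neg h

theorem memLoc_add (F : SmoothnessClass n) {X Y : (Fin n → ℝ) → Fin n → ℝ} (h : F.MemLoc X)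
    (h' : F.MemLoc Y) : F.MemLoc (X + Y) := by
  cases F with
  | contDiff k =>
    have h1 : ContDiff ℝ (k : WithTop ℕ∞) X := h
    have h2 : ContDiff ℝ (k : WithTop ℕ∞) Y := h'
    exact h1.add h2
  | holder k α _ =>
    refine ⟨ContDiff.add h.1 h'.1, fun u => ?_⟩
    obtain ⟨U, hU, C, hC⟩ := h.2 u
    obtain ⟨V, hV, D, hD⟩ := h'.2 u
    refine ⟨U ∩ V, inter_mem hU hV, C + D, fun a ha b hb => ?_⟩
    rw [iteratedFDeriv_add h.1 h'.1, Pi.add_apply, Pi.add_apply, ENNReal.coe_add, add_mul]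
    exact (edist_add_add_le _ _ _ _).trans (add_le_add (hC a ha.1 b hb.1) (hD a ha.2 b hb.2))
  | sobolev k p _ hp _ => exact MemSobolevLoc.add hp h h'

theorem small_zero (F : SmoothnessClass n) (j : ℕ) {ε : ℝ} (hε : 0 < ε) : F.Small j ε 0 := by
  cases F with
  | contDiff k => intro i _ _ u; rw [iteratedFDeriv_zero]; simpa using hε
  | holder k α _ =>
    refine ⟨fun i _ u => by rw [iteratedFDeriv_zero]; simpa using hε, fun u w => ?_⟩
    rw [iteratedFDeriv_zero]
    simp only [Pi.zero_apply, sub_self, norm_zero]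
    positivity
  | sobolev k p _ _ _ => exact SobolevLt.zero p hε k

theorem small_mono (F : SmoothnessClass n) {i j : ℕ} {ε δ : ℝ} (hij : i ≤ j) (h : δ ≤ ε)
    {Y : (Fin n → ℝ) → Fin n → ℝ} (hY : F.Small j δ Y) : F.Small i ε Y := by
  cases F with
  | contDiff k => exact fun l hl hk u => (hY l (hl.trans hij) hk u).trans_le h
  | holder k α _ =>
    exact ⟨fun l hl u => (hY.1 l hl u).trans_le h, fun u w => (hY.2 u w).trans
      (mul_le_mul_of_nonneg_right h (by positivity))⟩
  | sobolev k p _ _ _ => exact SobolevLt.mono h hY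

theorem small_neg (F : SmoothnessClass n) {j : ℕ} {ε : ℝ}
    {Y : (Fin n → ℝ) → Fin n → ℝ} (hY : F.Small j ε Y) : F.Small j ε (-Y) := by
  cases F with
  | contDiff k =>
    intro i hi hk u
    rw [iteratedFDeriv_neg_apply, norm_neg]
    exact hY i hi hk u
  | holder k α _ =>
    refine ⟨fun i hi u => ?_, fun u w => ?_⟩
    · rw [iteratedFDeriv_neg_apply, norm_neg]
      exact hY.1 i hi u
    · rw [iteratedFDeriv_neg_apply, iteratedFDeriv_neg_apply, ← neg_sub', norm_neg]
      exact hY.2 u w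
  | sobolev k p _ _ _ => exact SobolevLt.neg hY

theorem small_add (F : SmoothnessClass n) {j : ℕ} {ε : ℝ} (hε : 0 < ε)
    {Y Z : (Fin n → ℝ) → Fin n → ℝ} (hmY : F.MemLoc Y) (hmZ : F.MemLoc Z)
    (hY : F.Small j (ε / 2) Y) (hZ : F.Small j (ε / 2) Z) : F.Small j ε (Y + Z) := by
  cases F with
  | contDiff k =>
    intro i hi hk u
    have hk' : ((i : ℕ∞) : WithTop ℕ∞) ≤ (k : WithTop ℕ∞) := by exact_mod_cast hk
    have h1 : ContDiff ℝ (k : WithTop ℕ∞) Y := hmY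
    have h2 : ContDiff ℝ (k : WithTop ℕ∞) Z := hmZ
    rw [iteratedFDeriv_add (h1.of_le hk') (h2.of_le hk'), Pi.add_apply]
    exact (norm_add_le _ _).trans_lt (by linarith [hY i hi hk u, hZ i hi hk u])
  | holder k α _ =>
    have hadd : ∀ i : ℕ, i ≤ k → iteratedFDeriv ℝ i (Y + Z) =
        iteratedFDeriv ℝ i Y + iteratedFDeriv ℝ i Z := by
      intro i hi
      exact iteratedFDeriv_add (hmY.1.of_le (by exact_mod_cast hi))
        (hmZ.1.of_le (by exact_mod_cast hi))
    refine ⟨fun i hi u => ?_, fun u w => ?_⟩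
    · rw [hadd i hi, Pi.add_apply]
      exact (norm_add_le _ _).trans_lt (by linarith [hY.1 i hi u, hZ.1 i hi u])
    · rw [hadd k le_rfl, Pi.add_apply, Pi.add_apply, add_sub_add_comm]
      exact (norm_add_le _ _).trans (by linarith [hY.2 u w, hZ.2 u w])
  | sobolev k p _ hp _ =>
    have h := SobolevLt.add hp (by positivity) (by positivity) hY hZ
    rw [add_halves] at h
    exact h

/-- The maps `𝕋ⁿ → 𝕋ⁿ` of class `F`, as a subgroup of all continuous maps. -/
def subgroup (F : SmoothnessClass n) :
    AddSubgroup C(UnitAddTorus (Fin n), UnitAddTorus (Fin n)) where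
  carrier := {x | F.Contains x}
  zero_mem' := ⟨0, continuous_zero, fun u => by simp [proj_zero], F.memLoc_zero⟩
  add_mem' := by
    rintro x y ⟨X, hX, hx, hX'⟩ ⟨Y, hY, hy, hY'⟩
    exact ⟨X + Y, hX.add hY, fun u => by simp [proj_add, hx, hy], F.memLoc_add hX' hY'⟩
  neg_mem' := by
    rintro x ⟨X, hX, hx, hX'⟩
    exact ⟨-X, hX.neg, fun u => by simp [proj_neg, hx], F.memLoc_neg hX'⟩

end SmoothnessClass

end Helpers

/-- The mapping group `𝓕(𝕋ⁿ, 𝕋ⁿ)` with pointwise operations. It is a separate type since its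
topology is not the compact-open one. -/
def MapGroup {n : ℕ} (F : SmoothnessClass n) : Type := F.subgroup

namespace MapGroup

variable {n : ℕ} (F : SmoothnessClass n)

instance : AddCommGroup (MapGroup F) := inferInstanceAs (AddCommGroup F.subgroup)

instance : FunLike (MapGroup F) (UnitAddTorus (Fin n)) (UnitAddTorus (Fin n)) where
  coe x := x.1
  coe_injective _ _ h := Subtype.ext (DFunLike.coe_injective h)

/-- The basic neighbourhoods of `0` in the mapping group: the maps `proj ∘ y`, where
`y : 𝕋ⁿ → ℝⁿ` is of class `F` and small in the norms of `F`. -/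
def basicNhd (j : ℕ) (ε : ℝ) : Set (MapGroup F) :=
  {x | ∃ y : C(UnitAddTorus (Fin n), Fin n → ℝ), (∀ v, x v = proj n (y v)) ∧
    F.MemLoc (fun u => y (proj n u)) ∧ F.Small j ε (fun u => y (proj n u))}

/-- The basic neighbourhoods form a basis of neighbourhoods of `0` of a group topology. -/
@[reducible] def filterBasis : AddGroupFilterBasis (MapGroup F) :=
  addGroupFilterBasisOfComm {U | ∃ j : ℕ, ∃ ε : ℝ, 0 < ε ∧ U = basicNhd F j ε}
    ⟨_, 0, 1, one_pos, rfl⟩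
    (by
      rintro _ _ ⟨i, ε, hε, rfl⟩ ⟨j, δ, hδ, rfl⟩
      refine ⟨_, ⟨max i j, min ε δ, lt_min hε hδ, rfl⟩, ?_⟩
      rintro x ⟨y, hy, hm, hs⟩
      exact ⟨⟨y, hy, hm, F.small_mono (le_max_left _ _) (min_le_left _ _) hs⟩,
        ⟨y, hy, hm, F.small_mono (le_max_right _ _) (min_le_right _ _) hs⟩⟩)
    (by
      rintro _ ⟨j, ε, hε, rfl⟩
      exact ⟨0, fun v => proj_zero.symm, F.memLoc_zero, F.small_zero j hε⟩)
    (by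
      rintro _ ⟨j, ε, hε, rfl⟩
      refine ⟨_, ⟨j, ε / 2, half_pos hε, rfl⟩, ?_⟩
      rintro _ ⟨x, ⟨y, hy, hm, hs⟩, x', ⟨y', hy', hm', hs'⟩, rfl⟩
      refine ⟨y + y', fun v => ?_, F.memLoc_add hm hm', F.small_add hε hm hm' hs hs'⟩
      have h : (x + x') v = x v + x' v := rfl
      exact h.trans (by rw [hy, hy', ContinuousMap.add_apply, proj_add]))
    (by
      rintro _ ⟨j, ε, hε, rfl⟩
      refine ⟨_, ⟨j, ε, hε, rfl⟩, ?_⟩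
      rintro x ⟨y, hy, hm, hs⟩
      refine ⟨-y, fun v => ?_, F.memLoc_neg hm, F.small_neg hs⟩
      have h : (-x) v = -x v := rfl
      rw [h, hy, ContinuousMap.neg_apply, proj_neg])

/-- The topology of the Lie group `𝓕(𝕋ⁿ, 𝕋ⁿ)`: the group topology for which
`y ↦ proj ∘ y`, from the space of functions `𝕋ⁿ → ℝⁿ` of class `F` with its usual norm or
(for `C^∞`) seminorms, is a local homeomorphism at `0`. -/
instance : TopologicalSpace (MapGroup F) := (filterBasis F).topology

instance : IsTopologicalAddGroup (MapGroup F) := (filterBasis F).isTopologicalAddGroup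

end MapGroup

/-- The group `π₀(𝓕(𝕋ⁿ, 𝕋ⁿ))` of connected components: the quotient by the identity component. -/
abbrev Pi0 {n : ℕ} (F : SmoothnessClass n) : Type :=
  MapGroup F ⧸ AddSubgroup.connectedComponentOfZero (MapGroup F)

end TorusMaps

/-! Components. A continuous lift `X` of `x` satisfies `X (u + e_j) = X u + A e_j` with an integer
matrix `A`, constant in `u` because a continuous integer-valued function on `ℝⁿ` is constant. This
`degreeHom` is a homomorphism, onto because `linear F A` has degree `A`. Basic neighbourhoods of `0`
consist of maps `proj ∘ y`, which have degree zero, so the kernel is open, hence clopen, and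
contains the identity component. Conversely a map of degree zero has a periodic lift, so it is `proj
∘ y`, and `t ↦ proj ∘ (t y)` joins it to `0`; continuity of this path rests on periodic functions of
class `F` having finite norms (`exists_small_smul`). Thus the kernel is the identity component
(`connectedComponentOfZero_eq_ker`). Matrix units give generators that miss points, since their
linear maps have a vanishing coordinate when `n ≥ 2`.

Range decreasing homomorphisms. Everything comes from using two coordinates at once. Put `g` in
coordinate `j` and `(g - a)²` in coordinate `k`, where `a` is a value of `g` representing coordinate
`j` of `f (single F j g)`. If `g` oscillates by less than `1`, coordinate `j` forces `g = a` at the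
point realising the value of `f` on the sum, so `f` kills `single F k ((g - a)²)`. Summing such
squares over small multiples of the sines and cosines of all coordinates gives a killed function `h`
with exactly one zero `v₀` (`exists_map_single_eq_zero`). Adding `h` in a coordinate where `x`
vanishes leaves `f x` unchanged but forces evaluation at `v₀` (`map_eq_of_coord_eq_zero`). Every map
is a sum of two maps, each with a vanishing coordinate. -/

namespace TorusMaps

/-! ### Regularity classes: linear post-composition, smooth maps, and scaling of periodic functions
-/

section Regularity

variable {n : ℕ}

theorem MemLpLoc.clm_comp {p : ℝ} {X : (Fin n → ℝ) → Fin n → ℝ} (hX : MemLpLoc p X)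
    (L : (Fin n → ℝ) →L[ℝ] (Fin n → ℝ)) : MemLpLoc p (L ∘ X) :=
  fun K hK => L.comp_memLp' (hX K hK)

theorem HasWeakPartial.clm_comp {i : Fin n} {X g : (Fin n → ℝ) → Fin n → ℝ}
    (hX : LocallyIntegrable X) (hg : LocallyIntegrable g) (h : HasWeakPartial i X g)
    (L : (Fin n → ℝ) →L[ℝ] (Fin n → ℝ)) : HasWeakPartial i (L ∘ X) (L ∘ g) := by
  intro φ h1 h2
  have hc : Continuous fun u => fderiv ℝ φ u (Pi.single i 1) :=
    (h1.continuous_fderiv (by simp)).clm_apply continuous_const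
  have hs : HasCompactSupport fun u => fderiv ℝ φ u (Pi.single i 1) :=
    h2.fderiv_apply ℝ (Pi.single i 1)
  simp only [Function.comp_apply, ← map_smul]
  rw [L.integral_comp_comm (hg.integrable_smul_left_of_hasCompactSupport h1.continuous h2),
    L.integral_comp_comm (hX.integrable_smul_left_of_hasCompactSupport hc hs), h φ h1 h2, map_neg]

theorem MemSobolevLoc.clm_comp {p : ℝ} (hp : 1 ≤ p) {k : ℕ} {X : (Fin n → ℝ) → Fin n → ℝ}
    (h : MemSobolevLoc p k X) (L : (Fin n → ℝ) →L[ℝ] (Fin n → ℝ)) :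
    MemSobolevLoc p k (L ∘ X) := by
  induction k generalizing X with
  | zero => exact MemLpLoc.clm_comp h L
  | succ k ih =>
    refine ⟨h.1.clm_comp L, fun i => ?_⟩
    obtain ⟨g, hg, hg'⟩ := h.2 i
    exact ⟨L ∘ g, hg.clm_comp (h.1.locallyIntegrable hp) (hg'.memLpLoc.locallyIntegrable hp) L,
      ih hg'⟩

theorem _root_.Continuous.memLpLoc {X : (Fin n → ℝ) → Fin n → ℝ} (hX : Continuous X) (p : ℝ) :
    MemLpLoc p X := by
  intro K hK
  have : IsFiniteMeasure (volume.restrict K) := ⟨by simpa using hK.measure_lt_top⟩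
  obtain ⟨C, hC⟩ := hK.exists_bound_of_continuousOn hX.continuousOn
  exact MemLp.of_bound hX.aestronglyMeasurable C
    ((ae_restrict_iff' hK.measurableSet).2 (Eventually.of_forall hC))

theorem hasWeakPartial_fderiv {X : (Fin n → ℝ) → Fin n → ℝ}
    (hX : ContDiff ℝ ((⊤ : ℕ∞) : WithTop ℕ∞) X) (i : Fin n) :
    HasWeakPartial i X (fun u => fderiv ℝ X u (Pi.single i 1)) := by
  intro φ h1 h2
  have hc : Continuous fun u => fderiv ℝ φ u (Pi.single i 1) :=
    (h1.continuous_fderiv (by simp)).clm_apply continuous_const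
  have hs : HasCompactSupport fun u => fderiv ℝ φ u (Pi.single i 1) :=
    h2.fderiv_apply ℝ (Pi.single i 1)
  have hc' : Continuous fun u => fderiv ℝ X u (Pi.single i 1) :=
    (hX.continuous_fderiv (by simp)).clm_apply continuous_const
  exact integral_smul_fderiv_eq_neg_fderiv_smul_of_integrable
    (hX.continuous.locallyIntegrable.integrable_smul_left_of_hasCompactSupport hc hs)
    (hc'.locallyIntegrable.integrable_smul_left_of_hasCompactSupport h1.continuous h2)
    (hX.continuous.locallyIntegrable.integrable_smul_left_of_hasCompactSupport h1.continuous h2)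
    (fun u _ => h1.differentiable (by simp) u) (fun u _ => hX.differentiable (by simp) u)

theorem memSobolevLoc_of_contDiff {X : (Fin n → ℝ) → Fin n → ℝ}
    (hX : ContDiff ℝ ((⊤ : ℕ∞) : WithTop ℕ∞) X) (p : ℝ) (k : ℕ) : MemSobolevLoc p k X := by
  induction k generalizing X with
  | zero => exact hX.continuous.memLpLoc p
  | succ k ih =>
    exact ⟨hX.continuous.memLpLoc p, fun i => ⟨_, hasWeakPartial_fderiv hX i,
      ih ((hX.fderiv_right (m := ((⊤ : ℕ∞) : WithTop ℕ∞)) (by simp)).clm_apply contDiff_const)⟩⟩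

/-- A `C¹` map is locally Lipschitz, and at distances at most `1` one has `d ≤ d ^ α`; the radius `1
/ 2` keeps distances in that range. -/
theorem exists_holderOnWith_of_contDiff {E : Type*} [NormedAddCommGroup E] [NormedSpace ℝ E]
    {E' : Type*} [NormedAddCommGroup E'] [NormedSpace ℝ E'] {G : E → E'} (hG : ContDiff ℝ 1 G)
    {α : NNReal} (hα : α ≤ 1) (u : E) : ∃ U ∈ 𝓝 u, ∃ C : NNReal, HolderOnWith C α G U := by
  obtain ⟨K, t, ht, hK⟩ := hG.contDiffAt.exists_lipschitzOnWith (x := u)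
  refine ⟨t ∩ Metric.ball u (1 / 2), inter_mem ht (Metric.ball_mem_nhds u (by norm_num)), K, ?_⟩
  intro a ha b hb
  refine (hK ha.1 hb.1).trans ?_
  gcongr
  have h1 : edist a b ≤ 1 := by
    rw [edist_dist, ← ENNReal.ofReal_one]
    refine ENNReal.ofReal_le_ofReal ((dist_triangle_right a b u).trans ?_)
    linarith [Metric.mem_ball.1 ha.2, Metric.mem_ball.1 hb.2]
  simpa using ENNReal.rpow_le_rpow_of_exponent_ge h1 (show (α : ℝ) ≤ 1 from mod_cast hα)

/-- Invariance under all integer translations. -/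
def IsPeriodic {E : Type*} (G : (Fin n → ℝ) → E) : Prop :=
  ∀ (m : Fin n → ℤ) (u : Fin n → ℝ), G (u + fun i => (m i : ℝ)) = G u

theorem sub_floor_mem_Icc (u : Fin n → ℝ) :
    (u + fun i => ((-⌊u i⌋ : ℤ) : ℝ)) ∈ Icc (0 : Fin n → ℝ) 1 := by
  constructor <;> intro i
  · have := Int.floor_le (u i)
    simpa using this
  · have := (Int.lt_floor_add_one (u i)).le
    simp only [Pi.add_apply, Int.cast_neg, Pi.one_apply]
    linarith

theorem IsPeriodic.exists_bound {E : Type*} [NormedAddCommGroup E] {G : (Fin n → ℝ) → E}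
    (hG : IsPeriodic G) (hc : Continuous G) : ∃ M, 0 ≤ M ∧ ∀ u, ‖G u‖ ≤ M := by
  obtain ⟨M, hM⟩ := (isCompact_Icc (a := (0 : Fin n → ℝ)) (b := 1)).exists_bound_of_continuousOn
    hc.continuousOn
  have h : ∀ u, ‖G u‖ ≤ M := fun u => by
    rw [← hG (fun i => -⌊u i⌋) u]
    exact hM _ (sub_floor_mem_Icc u)
  exact ⟨M, (norm_nonneg _).trans (h 0), h⟩

theorem IsPeriodic.iteratedFDeriv {Y : (Fin n → ℝ) → Fin n → ℝ} (hY : IsPeriodic Y) (k : ℕ) :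
    IsPeriodic (iteratedFDeriv ℝ k Y) := by
  intro m u
  rw [← iteratedFDeriv_comp_add_right]
  congr 1
  exact funext fun v => hY m v

/-- Compactness of the unit cube makes the local Hölder constants uniform at some scale `δ`. Beyond
that scale the sup bound `M` suffices, with constant `2 * M / δ ^ α`. -/
theorem IsPeriodic.exists_holder_bound {E : Type*} [NormedAddCommGroup E] {G : (Fin n → ℝ) → E}
    (hG : IsPeriodic G) (hc : Continuous G) {α : NNReal}
    (hloc : ∀ u, ∃ U ∈ 𝓝 u, ∃ C : NNReal, HolderOnWith C α G U) :
    ∃ C, 0 ≤ C ∧ ∀ u w, ‖G u - G w‖ ≤ C * ‖u - w‖ ^ (α : ℝ) := by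
  obtain ⟨M, hM0, hM⟩ := hG.exists_bound hc
  -- Only `u` is confined to the cube: `w` may lie just outside, so pairs straddling a face are
  -- covered.
  obtain ⟨C, δ, hC, hδ, h⟩ : ∃ C δ : ℝ, 0 ≤ C ∧ 0 < δ ∧ ∀ u ∈ Icc (0 : Fin n → ℝ) 1, ∀ w,
      ‖u - w‖ < δ → ‖G u - G w‖ ≤ C * ‖u - w‖ ^ (α : ℝ) := by
    refine (isCompact_Icc (a := (0 : Fin n → ℝ)) (b := 1)).induction_on
      (p := fun s => ∃ C δ : ℝ, 0 ≤ C ∧ 0 < δ ∧ ∀ u ∈ s, ∀ w,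
      ‖u - w‖ < δ → ‖G u - G w‖ ≤ C * ‖u - w‖ ^ (α : ℝ)) ?_ ?_ ?_ ?_
    · exact ⟨0, 1, le_rfl, one_pos, by simp⟩
    · rintro s t hst ⟨C, δ, hC, hδ, h⟩
      exact ⟨C, δ, hC, hδ, fun u hu => h u (hst hu)⟩
    · rintro s t ⟨C, δ, hC, hδ, h⟩ ⟨D, η, hD, hη, h'⟩
      refine ⟨max C D, min δ η, hC.trans (le_max_left _ _), lt_min hδ hη, ?_⟩
      rintro u (hu | hu) w hw
      · exact (h u hu w (hw.trans_le (min_le_left _ _))).trans (by gcongr; exact le_max_left _ _)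
      · exact (h' u hu w (hw.trans_le (min_le_right _ _))).trans
          (by gcongr; exact le_max_right _ _)
    · intro u₀ _
      obtain ⟨U, hU, C, hCU⟩ := hloc u₀
      obtain ⟨r, hr, hrU⟩ := Metric.mem_nhds_iff.1 hU
      refine ⟨Metric.ball u₀ (r / 2), mem_nhdsWithin_of_mem_nhds (Metric.ball_mem_nhds _ (by positivity)),
        C, r / 2, C.2, by positivity, fun u hu w hw => ?_⟩
      have hu' := Metric.mem_ball.1 hu
      have h1 : u ∈ U := hrU (Metric.mem_ball.2 (by linarith))
      have h2 : w ∈ U := hrU (Metric.mem_ball.2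
        ((dist_triangle_left w u₀ u).trans_lt (by rw [dist_eq_norm u w]; linarith)))
      have h3 := hCU.dist_le h1 h2
      rwa [dist_eq_norm, dist_eq_norm] at h3
  refine ⟨max C (2 * M / δ ^ (α : ℝ)), hC.trans (le_max_left _ _), fun u w => ?_⟩
  rcases lt_or_ge ‖u - w‖ δ with hlt | hge
  -- Both points are translated by the same integer vector, which preserves their difference.
  · have h1 := h _ (sub_floor_mem_Icc u) (w + fun i => ((-⌊u i⌋ : ℤ) : ℝ))
      (by simpa only [add_sub_add_right_eq_sub] using hlt)
    rw [hG (fun i => -⌊u i⌋) u, hG (fun i => -⌊u i⌋) w, add_sub_add_right_eq_sub] at h1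
    exact h1.trans (by gcongr; exact le_max_left _ _)
  · have h1 : ‖G u - G w‖ ≤ 2 * M := (norm_sub_le _ _).trans (by linarith [hM u, hM w])
    have h2 : 0 < δ ^ (α : ℝ) := by positivity
    have h3 : δ ^ (α : ℝ) ≤ ‖u - w‖ ^ (α : ℝ) := by gcongr
    calc ‖G u - G w‖ ≤ 2 * M / δ ^ (α : ℝ) * δ ^ (α : ℝ) := by
          rwa [div_mul_cancel₀ _ h2.ne']
      _ ≤ _ := by gcongr; exact le_max_right _ _

theorem MemSobolevLoc.exists_sobolevLt_smul {p : ℝ} {k : ℕ}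
    {X : (Fin n → ℝ) → Fin n → ℝ} (h : MemSobolevLoc p k X) {ε : ℝ} (hε : 0 < ε) :
    ∃ δ > 0, ∀ c : ℝ, |c| < δ → SobolevLt p ε k (c • X) := by
  have key : ∀ {Z : (Fin n → ℝ) → Fin n → ℝ}, MemLpLoc p Z → ∃ δ > 0, ∀ c : ℝ, |c| < δ →
      (MemLpLoc p (c • Z) ∧
      eLpNorm (c • Z) (ENNReal.ofReal p) (volume.restrict (Icc 0 1)) < ENNReal.ofReal ε) := by
    intro Z hZ
    have hfin := (hZ _ (isCompact_Icc (a := (0 : Fin n → ℝ)) (b := 1))).2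
    set N := eLpNorm Z (ENNReal.ofReal p) (volume.restrict (Icc 0 1)) with hN
    refine ⟨ε / (N.toReal + 1), by positivity, fun c hc =>
      ⟨fun K hK => (hZ K hK).const_smul c, ?_⟩⟩
    rw [eLpNorm_const_smul, ← hN, ← ENNReal.ofReal_toReal hfin.ne, Real.enorm_eq_ofReal_abs,
      ← ENNReal.ofReal_mul (abs_nonneg c)]
    refine (ENNReal.ofReal_lt_ofReal_iff hε).2 ?_
    rw [lt_div_iff₀ (by positivity)] at hc
    nlinarith [abs_nonneg c, ENNReal.toReal_nonneg (a := N)]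
  have hw : ∀ {i : Fin n} {Z g : (Fin n → ℝ) → Fin n → ℝ} (c : ℝ), HasWeakPartial i Z g →
      HasWeakPartial i (c • Z) (c • g) := by
    intro i Z g c hg φ h1 h2
    simp only [Pi.smul_apply, smul_comm _ c]
    rw [integral_smul, integral_smul, hg φ h1 h2, smul_neg]
  induction k generalizing X with
  | zero => exact key h
  | succ k ih =>
    obtain ⟨δ, hδ, h1⟩ := key h.1
    choose g hg hg' using h.2
    choose η hη h2 using fun i => ih (hg' i)
    -- There are finitely many directions, so the thresholds have a positive minimum; with no
    -- directions any positive number will do.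
    obtain ⟨θ, hθ, h3⟩ : ∃ θ > 0, ∀ i, θ ≤ η i := by
      rcases isEmpty_or_nonempty (Fin n) with he | he
      · exact ⟨1, one_pos, fun i => he.elim i⟩
      · obtain ⟨i, hi⟩ := Finite.exists_min η
        exact ⟨η i, hη i, hi⟩
    exact ⟨min δ θ, lt_min hδ hθ, fun c hc => ⟨h1 c (hc.trans_le (min_le_left _ _)), fun i =>
      ⟨c • g i, hw c (hg i), h2 i c (hc.trans_le ((min_le_right _ _).trans (h3 i)))⟩⟩⟩

namespace SmoothnessClass

/-- Needed for two linear maps: scaling, for the path from `0` to `proj ∘ y`, and erasing a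
coordinate. -/
theorem memLoc_clm_comp (F : SmoothnessClass n) {X : (Fin n → ℝ) → Fin n → ℝ} (h : F.MemLoc X)
    (L : (Fin n → ℝ) →L[ℝ] (Fin n → ℝ)) : F.MemLoc (L ∘ X) := by
  cases F with
  | contDiff k =>
    have h1 : ContDiff ℝ (k : WithTop ℕ∞) X := h
    exact L.contDiff.comp h1
  | holder k α _ =>
    refine ⟨L.contDiff.comp h.1, fun u => ?_⟩
    obtain ⟨U, hU, C, hC⟩ := h.2 u
    let Φ := ContinuousLinearMap.compContinuousMultilinearMapL ℝ
      (fun _ : Fin k => Fin n → ℝ) (Fin n → ℝ) (Fin n → ℝ) L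
    have h2 : iteratedFDeriv ℝ k (L ∘ X) = Φ ∘ iteratedFDeriv ℝ k X := by
      funext v
      exact L.iteratedFDeriv_comp_left h.1.contDiffAt le_rfl
    refine ⟨U, hU, ‖Φ‖₊ * C, fun a ha b hb => ?_⟩
    rw [h2]
    refine (Φ.lipschitz _ _).trans ?_
    rw [ENNReal.coe_mul, mul_assoc]
    gcongr
    exact hC a ha b hb
  | sobolev k p _ hp _ => exact MemSobolevLoc.clm_comp hp h L

theorem memLoc_of_contDiff (F : SmoothnessClass n) {X : (Fin n → ℝ) → Fin n → ℝ}
    (hX : ContDiff ℝ ((⊤ : ℕ∞) : WithTop ℕ∞) X) : F.MemLoc X := by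
  cases F with
  | contDiff k =>
    have h : ContDiff ℝ (k : WithTop ℕ∞) X := hX.of_le (by exact_mod_cast le_top)
    exact h
  | holder k α hα =>
    refine ⟨hX.of_le (by exact_mod_cast le_top), exists_holderOnWith_of_contDiff ?_ hα⟩
    exact hX.iteratedFDeriv_right (m := 1) (i := k) (by exact_mod_cast le_top)
  | sobolev k p _ _ _ => exact memSobolevLoc_of_contDiff hX p k

theorem exists_small_smul (F : SmoothnessClass n) {Y : (Fin n → ℝ) → Fin n → ℝ}
    (hY : IsPeriodic Y) (h : F.MemLoc Y) (j : ℕ) {ε : ℝ} (hε : 0 < ε) :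
    ∃ δ > 0, ∀ c : ℝ, |c| < δ → F.Small j ε (c • Y) := by
  -- The `+ 1` keeps the denominator positive even when the norm vanishes.
  have bd : ∀ {M c : ℝ}, 0 ≤ M → |c| < ε / (M + 1) → |c| * M < ε := by
    intro M c hM hc
    rw [lt_div_iff₀ (by positivity)] at hc
    nlinarith [abs_nonneg c]
  cases F with
  | contDiff k =>
    have h1 : ContDiff ℝ (k : WithTop ℕ∞) Y := h
    -- Orders above `k` are not constrained by the norm, so they get the bound `0` and drop out of
    -- the sum.
    have hb : ∀ i : ℕ, ∃ M, 0 ≤ M ∧ ((i : ℕ∞) ≤ k → ∀ u, ‖iteratedFDeriv ℝ i Y u‖ ≤ M) := by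
      intro i
      by_cases hi : (i : ℕ∞) ≤ k
      · obtain ⟨M, hM0, hM⟩ := (hY.iteratedFDeriv i).exists_bound
          (h1.continuous_iteratedFDeriv (by exact_mod_cast hi))
        exact ⟨M, hM0, fun _ => hM⟩
      · exact ⟨0, le_rfl, fun h => absurd h hi⟩
    choose M hM0 hM using hb
    have hS : 0 ≤ ∑ i ∈ Finset.range (j + 1), M i := Finset.sum_nonneg fun i _ => hM0 i
    refine ⟨ε / (∑ i ∈ Finset.range (j + 1), M i + 1), by positivity, fun c hc i hi hk u => ?_⟩
    rw [iteratedFDeriv_const_smul_apply (h1.of_le (by exact_mod_cast hk)).contDiffAt, norm_smul,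
      Real.norm_eq_abs]
    refine lt_of_le_of_lt ?_ (bd hS hc)
    gcongr
    exact (hM i hk u).trans
      (Finset.single_le_sum (fun i _ => hM0 i) (Finset.mem_range.2 (by lia)))
  | holder k α _ =>
    choose M hM0 hM using fun i : Fin (k + 1) => (hY.iteratedFDeriv (i : ℕ)).exists_bound
      (h.1.continuous_iteratedFDeriv (by exact_mod_cast Nat.lt_succ_iff.1 i.2))
    obtain ⟨C, hC0, hC⟩ := (hY.iteratedFDeriv k).exists_holder_bound
      (h.1.continuous_iteratedFDeriv le_rfl) h.2
    have hS : 0 ≤ ∑ i, M i := Finset.sum_nonneg fun i _ => hM0 i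
    have hsm : ∀ (c : ℝ) (i : ℕ), i ≤ k → ∀ u, iteratedFDeriv ℝ i (c • Y) u =
        c • iteratedFDeriv ℝ i Y u := fun c i hi u =>
      iteratedFDeriv_const_smul_apply (h.1.of_le (by exact_mod_cast hi)).contDiffAt
    refine ⟨ε / (∑ i, M i + C + 1), by positivity, fun c hc => ?_⟩
    have hb := bd (add_nonneg hS hC0) hc
    refine ⟨fun i hi u => ?_, fun u w => ?_⟩
    · rw [hsm c i hi, norm_smul, Real.norm_eq_abs]
      refine lt_of_le_of_lt ?_ hb
      gcongr
      have h2 := Finset.single_le_sum (fun i _ => hM0 i)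
        (Finset.mem_univ (⟨i, Nat.lt_succ_of_le hi⟩ : Fin (k + 1)))
      linarith [hM ⟨i, Nat.lt_succ_of_le hi⟩ u]
    · rw [hsm c k le_rfl, hsm c k le_rfl, ← smul_sub, norm_smul, Real.norm_eq_abs]
      calc |c| * _ ≤ |c| * (C * ‖u - w‖ ^ (α : ℝ)) := by gcongr; exact hC u w
        _ = (|c| * C) * ‖u - w‖ ^ (α : ℝ) := by ring
        _ ≤ ε * ‖u - w‖ ^ (α : ℝ) := by
          gcongr
          nlinarith [abs_nonneg c]
  | sobolev k p _ _ _ => exact MemSobolevLoc.exists_sobolevLt_smul h hε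

end SmoothnessClass

end Regularity

/-! ### The covering `ℝⁿ → 𝕋ⁿ`: integer ambiguity and descent of periodic maps -/

section Lifts

variable {n : ℕ}

theorem exists_int_of_coe_eq {a b : ℝ} (h : (a : UnitAddCircle) = b) :
    ∃ m : ℤ, a = b + m := by
  have h1 : ((a - b : ℝ) : UnitAddCircle) = 0 := by rw [AddCircle.coe_sub, h, sub_self]
  obtain ⟨m, hm⟩ := (AddCircle.coe_eq_zero_iff 1).1 h1
  exact ⟨m, by simp at hm; linarith⟩

theorem eq_of_coe_eq_of_abs_sub_lt {a b : ℝ} (h : (a : UnitAddCircle) = b) (hab : |a - b| < 1) :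
    a = b := by
  obtain ⟨m, rfl⟩ := exists_int_of_coe_eq h
  rw [add_sub_cancel_left] at hab
  have : m = 0 := Int.abs_lt_one_iff.1 (by exact_mod_cast hab)
  simp [this]

theorem eq_of_forall_exists_int {G : (Fin n → ℝ) → ℝ} (hG : Continuous G)
    (h : ∀ u, ∃ m : ℤ, G u = m) (u v : Fin n → ℝ) : G u = G v := by
  choose m hm using h
  have hm' : G = (fun z : ℤ => (z : ℝ)) ∘ m := funext hm
  have hc : Continuous m :=
    Int.isClosedEmbedding_coe_real.isInducing.continuous_iff.2 (by rw [← hm']; exact hG)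
  rw [hm, hm, PreconnectedSpace.constant inferInstance hc (x := u) (y := v)]

theorem proj_add_int (u : Fin n → ℝ) (m : Fin n → ℤ) :
    proj n (u + fun i => (m i : ℝ)) = proj n u := by
  ext i
  simp [proj]

theorem proj_add_single (u : Fin n → ℝ) (j : Fin n) : proj n (u + Pi.single j 1) = proj n u := by
  rw [← proj_add_int u (Pi.single j 1)]
  congr 2
  ext i
  by_cases h : i = j
  · subst h; simp
  · simp [h]

theorem exists_int_of_proj_eq {u v : Fin n → ℝ} (h : proj n u = proj n v) :
    ∃ m : Fin n → ℤ, u = v + fun i => (m i : ℝ) := by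
  choose m hm using fun i => exists_int_of_coe_eq (congrFun h i)
  exact ⟨m, funext hm⟩

theorem isOpenQuotientMap_proj : IsOpenQuotientMap (proj n) :=
  IsOpenQuotientMap.piMap fun _ => QuotientAddGroup.isOpenQuotientMap_mk

theorem isPeriodic_comp_proj {E : Type*} (y : UnitAddTorus (Fin n) → E) :
    IsPeriodic fun u => y (proj n u) :=
  fun m u => congrArg y (proj_add_int u m)

/-- The periods of `G` form a subgroup, and the unit vectors generate `ℤⁿ`. -/
theorem isPeriodic_of_single {E : Type*} {G : (Fin n → ℝ) → E}
    (h : ∀ j u, G (u + Pi.single j 1) = G u) : IsPeriodic G := by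
  let S : AddSubgroup (Fin n → ℝ) :=
    { carrier := {w | ∀ u, G (u + w) = G u}
      zero_mem' := fun u => by rw [add_zero]
      add_mem' := fun {a b} ha hb u => by rw [← add_assoc, hb, ha]
      neg_mem' := fun {a} ha u => by rw [← ha (u + -a), neg_add_cancel_right] }
  intro m
  have h1 : (fun i => (m i : ℝ)) = ∑ j, m j • (Pi.single j 1 : Fin n → ℝ) := by
    ext i
    simp [Finset.sum_apply, Pi.single_apply]
  have h2 : (fun i => (m i : ℝ)) ∈ S := by
    rw [h1]
    exact S.sum_mem fun j _ => S.zsmul_mem (h j) _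
  exact h2

theorem IsPeriodic.exists_comp_proj {X : (Fin n → ℝ) → Fin n → ℝ} (hX : Continuous X)
    (h : IsPeriodic X) : ∃ y : C(UnitAddTorus (Fin n), Fin n → ℝ), ∀ u, y (proj n u) = X u := by
  have hf : ∀ u v, proj n u = proj n v → X u = X v := by
    intro u v huv
    obtain ⟨m, rfl⟩ := exists_int_of_proj_eq huv
    exact h m v
  choose s hs using (isOpenQuotientMap_proj (n := n)).surjective
  have hs' : ∀ u, X (s (proj n u)) = X u := fun u => hf _ _ (hs _)
  refine ⟨⟨X ∘ s, isOpenQuotientMap_proj.isQuotientMap.continuous_iff.2 ?_⟩, hs'⟩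
  rwa [show (X ∘ s) ∘ proj n = X from funext hs']

end Lifts

/-! ### The degree matrix and the group of components -/

namespace MapGroup

variable {n : ℕ} (F : SmoothnessClass n)

/-- A continuous map of class `F` as an element of the mapping group. -/
def ofMap (x : C(UnitAddTorus (Fin n), UnitAddTorus (Fin n))) (hx : F.Contains x) : MapGroup F :=
  (⟨x, hx⟩ : F.subgroup)

variable {F}

@[simp] theorem ofMap_apply (x : C(UnitAddTorus (Fin n), UnitAddTorus (Fin n)))
    (hx : F.Contains x) (v : UnitAddTorus (Fin n)) : ofMap F x hx v = x v := rfl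

@[simp] theorem add_apply (x y : MapGroup F) (v : UnitAddTorus (Fin n)) :
    (x + y) v = x v + y v := rfl

@[simp] theorem sub_apply (x y : MapGroup F) (v : UnitAddTorus (Fin n)) :
    (x - y) v = x v - y v := rfl

@[simp] theorem zero_apply (v : UnitAddTorus (Fin n)) : (0 : MapGroup F) v = 0 := rfl

theorem exists_lift (x : MapGroup F) : ∃ X : (Fin n → ℝ) → Fin n → ℝ,
    Continuous X ∧ (∀ u, proj n (X u) = x (proj n u)) ∧ F.MemLoc X := x.2

/-- A lift of `x` to the universal covers. -/
noncomputable def lift (x : MapGroup F) : (Fin n → ℝ) → Fin n → ℝ := x.exists_lift.choose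

theorem continuous_lift (x : MapGroup F) : Continuous x.lift := x.exists_lift.choose_spec.1

theorem proj_lift (x : MapGroup F) (u : Fin n → ℝ) : proj n (x.lift u) = x (proj n u) :=
  x.exists_lift.choose_spec.2.1 u

theorem memLoc_lift (x : MapGroup F) : F.MemLoc x.lift := x.exists_lift.choose_spec.2.2

theorem exists_degree (x : MapGroup F) : ∃ A : Matrix (Fin n) (Fin n) ℤ,
    ∀ i j u, x.lift (u + Pi.single j 1) i = x.lift u i + A i j := by
  have h1 : ∀ i j u, ∃ m : ℤ, x.lift (u + Pi.single j 1) i = x.lift u i + m := fun i j u =>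
    exists_int_of_coe_eq (congrFun
      (show proj n _ = proj n _ by rw [proj_lift, proj_lift, proj_add_single]) i)
  choose A hA using fun i j => h1 i j 0
  refine ⟨A, fun i j u => ?_⟩
  have hc := x.continuous_lift
  have h2 := eq_of_forall_exists_int (G := fun u => x.lift (u + Pi.single j 1) i - x.lift u i)
    (by fun_prop) (fun u => (h1 i j u).imp fun m hm => by simp only [hm, add_sub_cancel_left]) u 0
  simp only [hA i j, add_sub_cancel_left] at h2
  linarith

/-- The degree matrix of a map `𝕋ⁿ → 𝕋ⁿ`, its action on the fundamental group. -/
noncomputable def degree (x : MapGroup F) : Matrix (Fin n) (Fin n) ℤ := x.exists_degree.choose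

theorem lift_add_single (x : MapGroup F) (i j : Fin n) (u : Fin n → ℝ) :
    x.lift (u + Pi.single j 1) i = x.lift u i + x.degree i j := x.exists_degree.choose_spec i j u

/-- Two lifts of `x` differ by a constant integer vector, so the degree can be read off from any
lift, not only the chosen one. -/
theorem add_single_of_proj_eq (x : MapGroup F) {X : (Fin n → ℝ) → Fin n → ℝ} (hX : Continuous X)
    (h : ∀ u, proj n (X u) = x (proj n u)) (i j : Fin n) (u : Fin n → ℝ) :
    X (u + Pi.single j 1) i = X u i + x.degree i j := by
  have hc := x.continuous_lift
  have h1 := eq_of_forall_exists_int (G := fun u => X u i - x.lift u i) (by fun_prop)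
    (fun u => (exists_int_of_coe_eq (congrFun ((h u).trans (x.proj_lift u).symm) i)).imp
      fun m hm => by simp only [hm, add_sub_cancel_left]) (u + Pi.single j 1) u
  simp only [lift_add_single] at h1
  linarith

theorem degree_eq_of_lift (x : MapGroup F) {X : (Fin n → ℝ) → Fin n → ℝ} (hX : Continuous X)
    (h : ∀ u, proj n (X u) = x (proj n u)) {A : Matrix (Fin n) (Fin n) ℤ}
    (hA : ∀ i j, X (Pi.single j 1) i = X 0 i + A i j) : x.degree = A := by
  ext i j
  have h1 := x.add_single_of_proj_eq hX h i j 0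
  rw [zero_add, hA, add_right_inj] at h1
  exact_mod_cast h1.symm

variable (F) in
/-- The degree matrix as a homomorphism. -/
noncomputable def degreeHom : MapGroup F →+ Matrix (Fin n) (Fin n) ℤ :=
  AddMonoidHom.mk' degree fun x y => by
    refine degree_eq_of_lift (x + y) (x.continuous_lift.add y.continuous_lift)
      (fun u => by rw [Pi.add_apply, proj_add, proj_lift, proj_lift]; rfl) fun i j => ?_
    have h1 := x.lift_add_single i j 0
    have h2 := y.lift_add_single i j 0
    rw [zero_add] at h1 h2
    simp only [Pi.add_apply, h1, h2, Matrix.add_apply, Int.cast_add]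
    ring

variable (F) in
/-- The linear endomorphism of the torus given by an integer matrix. -/
noncomputable def linear (A : Matrix (Fin n) (Fin n) ℤ) : MapGroup F :=
  ofMap F ⟨fun v i => ∑ j, A i j • v j, by fun_prop⟩ <| by
    have h : ContDiff ℝ ((⊤ : ℕ∞) : WithTop ℕ∞)
        (fun (u : Fin n → ℝ) (i : Fin n) => ∑ j, (A i j : ℝ) * u j) := by fun_prop
    refine ⟨_, h.continuous, fun u => ?_, F.memLoc_of_contDiff h⟩
    ext i
    simp [proj, ← zsmul_eq_mul]

theorem linear_apply (A : Matrix (Fin n) (Fin n) ℤ) (v : UnitAddTorus (Fin n)) (i : Fin n) :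
    linear F A v i = ∑ j, A i j • v j := rfl

theorem degree_linear (A : Matrix (Fin n) (Fin n) ℤ) : degreeHom F (linear F A) = A := by
  refine degree_eq_of_lift _ (X := fun (u : Fin n → ℝ) (i : Fin n) => ∑ j, (A i j : ℝ) * u j)
    (by fun_prop) (fun u => ?_) fun i j => ?_
  · ext i
    rw [linear_apply]
    simp [proj, ← zsmul_eq_mul]
  · simp [Pi.single_apply]

/-- The map `proj ∘ y`. -/
def ofReal (y : C(UnitAddTorus (Fin n), Fin n → ℝ)) (hy : F.MemLoc fun u => y (proj n u)) :
    MapGroup F :=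
  ofMap F ⟨fun v => proj n (y v), continuous_proj.comp y.continuous⟩
    ⟨_, y.continuous.comp continuous_proj, fun _ => rfl, hy⟩

theorem degree_eq_zero_of_eq_proj (x : MapGroup F) (y : C(UnitAddTorus (Fin n), Fin n → ℝ))
    (h : ∀ v, x v = proj n (y v)) : degreeHom F x = 0 := by
  refine x.degree_eq_of_lift (X := fun u => y (proj n u)) (y.continuous.comp continuous_proj)
    (fun u => (h _).symm) fun i j => ?_
  rw [← zero_add (Pi.single j 1 : Fin n → ℝ), proj_add_single]
  simp

theorem exists_eq_proj_of_degree_eq_zero (x : MapGroup F) (h : degreeHom F x = 0) :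
    ∃ y : C(UnitAddTorus (Fin n), Fin n → ℝ), (F.MemLoc fun u => y (proj n u)) ∧
      ∀ v, x v = proj n (y v) := by
  have hp : IsPeriodic x.lift := isPeriodic_of_single fun j u => by
    ext i
    rw [lift_add_single, show x.degree = 0 from h]
    simp
  obtain ⟨y, hy⟩ := hp.exists_comp_proj x.continuous_lift
  refine ⟨y, by simpa only [hy] using x.memLoc_lift, fun v => ?_⟩
  obtain ⟨u, rfl⟩ := (isOpenQuotientMap_proj (n := n)).surjective v
  rw [hy, proj_lift]

theorem hasBasis_nhds_zero : (𝓝 (0 : MapGroup F)).HasBasis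
    (fun p : ℕ × ℝ => 0 < p.2) fun p => basicNhd F p.1 p.2 := by
  have h := (filterBasis F).nhds_zero_hasBasis
  refine ⟨fun t => h.mem_iff.trans ⟨?_, ?_⟩⟩
  · rintro ⟨_, ⟨j, ε, hε, rfl⟩, ht⟩
    exact ⟨(j, ε), hε, ht⟩
  · rintro ⟨⟨j, ε⟩, hε, ht⟩
    exact ⟨_, ⟨j, ε, hε, rfl⟩, ht⟩

/-- The one-parameter subgroup `t ↦ proj ∘ (t y)`. -/
noncomputable def expHom (y : C(UnitAddTorus (Fin n), Fin n → ℝ))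
    (hy : F.MemLoc fun u => y (proj n u)) : ℝ →+ MapGroup F :=
  AddMonoidHom.mk' (fun t => ofReal (t • y)
    (F.memLoc_clm_comp hy (t • ContinuousLinearMap.id ℝ (Fin n → ℝ)))) fun s t =>
      DFunLike.ext _ _ fun v => by
        change proj n ((s + t) • y v) = proj n (s • y v) + proj n (t • y v)
        rw [add_smul, proj_add]

/-- For a homomorphism continuity at `0` is enough, and there it says that small multiples of `y`
are small in the norms of `F`. -/
theorem continuous_expHom (y : C(UnitAddTorus (Fin n), Fin n → ℝ))
    (hy : F.MemLoc fun u => y (proj n u)) : Continuous (expHom y hy) := by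
  refine continuous_of_continuousAt_zero _ ?_
  rw [ContinuousAt, map_zero, hasBasis_nhds_zero.tendsto_right_iff]
  rintro ⟨j, ε⟩ hε
  obtain ⟨δ, hδ, h⟩ := F.exists_small_smul (isPeriodic_comp_proj y) hy j hε
  filter_upwards [Metric.ball_mem_nhds (0 : ℝ) hδ] with t ht
  rw [mem_ball_zero_iff, Real.norm_eq_abs] at ht
  exact ⟨t • y, fun _ => rfl,
    F.memLoc_clm_comp hy (t • ContinuousLinearMap.id ℝ (Fin n → ℝ)), h t ht⟩

variable (F) in
theorem connectedComponentOfZero_eq_ker :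
    AddSubgroup.connectedComponentOfZero (MapGroup F) = (degreeHom F).ker := by
  apply le_antisymm
  · have hopen : IsOpen ((degreeHom F).ker : Set (MapGroup F)) := by
      refine AddSubgroup.isOpen_of_mem_nhds _ (g := 0) ?_
      refine mem_of_superset (hasBasis_nhds_zero.mem_of_mem (i := (0, 1)) one_pos) ?_
      rintro x ⟨y, hy, -, -⟩
      exact x.degree_eq_zero_of_eq_proj y hy
    have hclopen : IsClopen ((degreeHom F).ker : Set (MapGroup F)) :=
      ⟨AddSubgroup.isClosed_of_isOpen _ hopen, hopen⟩
    exact hclopen.connectedComponent_subset (zero_mem _)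
  · intro x hx
    obtain ⟨y, hm, hy⟩ := x.exists_eq_proj_of_degree_eq_zero hx
    have h1 : expHom y hm 1 = x := DFunLike.ext _ _ fun v => by
      rw [hy]
      change proj n ((1 : ℝ) • y v) = _
      rw [one_smul]
    exact (isPreconnected_range (continuous_expHom y hm)).subset_connectedComponent
      ⟨0, map_zero _⟩ ⟨1, h1⟩

variable (F) in
/-- The degree identifies the group of connected components with the integer matrices. -/
noncomputable def pi0Equiv : Pi0 F ≃+ Matrix (Fin n) (Fin n) ℤ :=
  (QuotientAddGroup.quotientAddEquivOfEq (connectedComponentOfZero_eq_ker F)).trans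
    (QuotientAddGroup.quotientKerEquivOfSurjective (degreeHom F)
      (show Function.Surjective (degreeHom F) from fun A => ⟨linear F A, degree_linear A⟩))

theorem pi0Equiv_mk (x : MapGroup F) : pi0Equiv F (QuotientAddGroup.mk x) = degreeHom F x := rfl

variable (F) in
theorem closure_range_ne_univ_eq_top (hn : 2 ≤ n) :
    AddSubgroup.closure {c : Pi0 F | ∃ x₀ : MapGroup F,
      Set.range x₀ ≠ Set.univ ∧ c = QuotientAddGroup.mk x₀} = ⊤ := by
  rw [eq_top_iff]
  intro c _
  -- Expand the degree matrix in matrix units and transport back through the isomorphism.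
  have h1 : c = ∑ i, ∑ j, pi0Equiv F c i j •
      (QuotientAddGroup.mk (linear F (Matrix.single i j 1)) : Pi0 F) := by
    apply (pi0Equiv F).injective
    simp only [map_sum, map_zsmul, pi0Equiv_mk, degree_linear]
    conv_lhs => rw [Matrix.matrix_eq_sum_single (pi0Equiv F c)]
    simp [Matrix.smul_single]
  rw [h1]
  refine sum_mem fun i _ => sum_mem fun j _ => zsmul_mem (AddSubgroup.subset_closure ?_) _
  refine ⟨_, fun hu => ?_, rfl⟩
  have : Nontrivial (Fin n) := Fin.nontrivial_iff_two_le.2 hn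
  obtain ⟨k, hk⟩ := exists_ne i
  -- Row `k ≠ i` of the matrix unit is zero, so coordinate `k` of the map is identically `0` and the
  -- value `1 / 2` is never taken there.
  obtain ⟨v, hv⟩ := hu.ge (mem_univ (fun _ => ((1 / 2 : ℝ) : UnitAddCircle)))
  have h2 : ((0 : ℝ) : UnitAddCircle) = ((1 / 2 : ℝ) : UnitAddCircle) := by
    rw [← congrFun hv k, linear_apply]
    simp [hk.symm]
  have h3 := eq_of_coe_eq_of_abs_sub_lt h2 (by norm_num [abs_lt])
  norm_num at h3

end MapGroup

/-! ### Smooth test functions on the torus that separate points -/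

section SmoothFunctions

/-- The algebra of smooth real functions on the torus. -/
def smoothFunctions (n : ℕ) : Subalgebra ℝ C(UnitAddTorus (Fin n), ℝ) where
  carrier := {g | ContDiff ℝ ((⊤ : ℕ∞) : WithTop ℕ∞) fun u => g (proj n u)}
  mul_mem' {a b} ha hb := by
    have ha' : ContDiff ℝ ((⊤ : ℕ∞) : WithTop ℕ∞) fun u => a (proj n u) := ha
    have hb' : ContDiff ℝ ((⊤ : ℕ∞) : WithTop ℕ∞) fun u => b (proj n u) := hb
    exact ha'.mul hb'
  add_mem' {a b} ha hb := by
    have ha' : ContDiff ℝ ((⊤ : ℕ∞) : WithTop ℕ∞) fun u => a (proj n u) := ha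
    have hb' : ContDiff ℝ ((⊤ : ℕ∞) : WithTop ℕ∞) fun u => b (proj n u) := hb
    exact ha'.add hb'
  algebraMap_mem' r := by
    have h : ContDiff ℝ ((⊤ : ℕ∞) : WithTop ℕ∞) fun _ : Fin n → ℝ => r := contDiff_const
    exact h

variable {n : ℕ}

theorem mem_smoothFunctions {g : C(UnitAddTorus (Fin n), ℝ)} : g ∈ smoothFunctions n ↔
    ContDiff ℝ ((⊤ : ℕ∞) : WithTop ℕ∞) fun u => g (proj n u) := Iff.rfl

/-- The function `v ↦ c cos (2π vᵢ)`. -/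
noncomputable def cosCoord (c : ℝ) (i : Fin n) : smoothFunctions n :=
  ⟨⟨fun v => c * (AddCircle.toCircle (v i) : ℂ).re, by
    have := AddCircle.continuous_toCircle (T := (1 : ℝ))
    fun_prop⟩, by
    have h : ∀ u : Fin n → ℝ, c * (AddCircle.toCircle (proj n u i) : ℂ).re =
        c * Real.cos (2 * Real.pi * u i) := fun u => by
      simp [proj, AddCircle.toCircle_apply_mk, Circle.coe_exp, Complex.exp_ofReal_mul_I_re,
        -Complex.ofReal_mul]
    simp only [mem_smoothFunctions, ContinuousMap.coe_mk, h]
    fun_prop⟩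

/-- The function `v ↦ c sin (2π vᵢ)`. -/
noncomputable def sinCoord (c : ℝ) (i : Fin n) : smoothFunctions n :=
  ⟨⟨fun v => c * (AddCircle.toCircle (v i) : ℂ).im, by
    have := AddCircle.continuous_toCircle (T := (1 : ℝ))
    fun_prop⟩, by
    have h : ∀ u : Fin n → ℝ, c * (AddCircle.toCircle (proj n u i) : ℂ).im =
        c * Real.sin (2 * Real.pi * u i) := fun u => by
      simp [proj, AddCircle.toCircle_apply_mk, Circle.coe_exp, Complex.exp_ofReal_mul_I_im,
        -Complex.ofReal_mul]
    simp only [mem_smoothFunctions, ContinuousMap.coe_mk, h]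
    fun_prop⟩

theorem cosCoord_apply (c : ℝ) (i : Fin n) (v : UnitAddTorus (Fin n)) :
    (cosCoord c i).1 v = c * (AddCircle.toCircle (v i) : ℂ).re := rfl

theorem sinCoord_apply (c : ℝ) (i : Fin n) (v : UnitAddTorus (Fin n)) :
    (sinCoord c i).1 v = c * (AddCircle.toCircle (v i) : ℂ).im := rfl

theorem abs_cosCoord_le {c : ℝ} (hc : 0 ≤ c) (i : Fin n) (v : UnitAddTorus (Fin n)) :
    |(cosCoord c i).1 v| ≤ c := by
  rw [cosCoord_apply, abs_mul, abs_of_nonneg hc]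
  exact mul_le_of_le_one_right hc ((Complex.abs_re_le_norm _).trans_eq (Circle.norm_coe _))

theorem abs_sinCoord_le {c : ℝ} (hc : 0 ≤ c) (i : Fin n) (v : UnitAddTorus (Fin n)) :
    |(sinCoord c i).1 v| ≤ c := by
  rw [sinCoord_apply, abs_mul, abs_of_nonneg hc]
  exact mul_le_of_le_one_right hc ((Complex.abs_im_le_norm _).trans_eq (Circle.norm_coe _))

theorem eq_of_cosCoord_eq_of_sinCoord_eq {c : ℝ} (hc : c ≠ 0) {v w : UnitAddTorus (Fin n)}
    (h : ∀ i, (cosCoord c i).1 v = (cosCoord c i).1 w)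
    (h' : ∀ i, (sinCoord c i).1 v = (sinCoord c i).1 w) : v = w := by
  ext i
  refine AddCircle.injective_toCircle one_ne_zero (Circle.ext (Complex.ext ?_ ?_))
  · exact mul_left_cancel₀ hc (h i)
  · exact mul_left_cancel₀ hc (h' i)

/-- The square `(g - a)²`. -/
noncomputable def sqSub (g : smoothFunctions n) (a : ℝ) : smoothFunctions n :=
  (g - algebraMap ℝ _ a) ^ 2

theorem sqSub_apply (g : smoothFunctions n) (a : ℝ) (v : UnitAddTorus (Fin n)) :
    (sqSub g a).1 v = (g.1 v - a) ^ 2 := rfl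

end SmoothFunctions

/-! ### Range decreasing homomorphisms are evaluations -/

namespace MapGroup

variable {n : ℕ} (F : SmoothnessClass n)

/-- The map with `k`-th coordinate `proj ∘ h` and the other coordinates zero. -/
def single (k : Fin n) : smoothFunctions n →+ MapGroup F :=
  AddMonoidHom.mk' (fun h => ofReal ⟨fun v => Pi.single k (h.1 v),
      (continuous_single k).comp h.1.continuous⟩
    (F.memLoc_of_contDiff (contDiff_pi.2 fun i => by
      by_cases hi : i = k
      · subst hi
        simpa only [ContinuousMap.coe_mk, Pi.single_eq_same] using mem_smoothFunctions.1 h.2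
      · simp only [ContinuousMap.coe_mk, Pi.single_eq_of_ne hi]
        exact contDiff_const))) fun g h => DFunLike.ext _ _ fun v => by
    change proj n (Pi.single k (g.1 v + h.1 v)) =
      proj n (Pi.single k (g.1 v)) + proj n (Pi.single k (h.1 v))
    rw [← proj_add, Pi.single_add]

variable {F}

theorem single_apply_same (k : Fin n) (h : smoothFunctions n) (v : UnitAddTorus (Fin n)) :
    single F k h v k = (h.1 v : UnitAddCircle) := by
  change proj n (Pi.single k (h.1 v)) k = _
  simp [proj]

theorem single_apply_of_ne {k i : Fin n} (hi : i ≠ k) (h : smoothFunctions n)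
    (v : UnitAddTorus (Fin n)) : single F k h v i = 0 := by
  change proj n (Pi.single k (h.1 v)) i = _
  simp [proj, hi]

theorem single_apply_eq_zero (k : Fin n) {h : smoothFunctions n} {v : UnitAddTorus (Fin n)}
    (hv : h.1 v = 0) : single F k h v = 0 := by
  ext i
  by_cases hi : i = k
  · subst hi
    simp [single_apply_same, hv]
  · simp [single_apply_of_ne hi]

/-- Replacing the `k`-th coordinate of a map by zero preserves its class. -/
theorem exists_eraseCoord (x : MapGroup F) (k : Fin n) : ∃ y : MapGroup F,
    (∀ v, y v k = 0) ∧ ∀ v, ∀ i ≠ k, y v i = x v i := by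
  have hx : Continuous x := map_continuous x.1
  let L : (Fin n → ℝ) →L[ℝ] (Fin n → ℝ) :=
    ContinuousLinearMap.pi fun i => if i = k then 0 else ContinuousLinearMap.proj i
  refine ⟨ofMap F ⟨fun v i => if i = k then 0 else x v i, continuous_pi fun i => ?_⟩
    (show F.Contains _ from ⟨L ∘ x.lift, L.continuous.comp x.continuous_lift, fun u => ?_,
      F.memLoc_clm_comp x.memLoc_lift L⟩), fun v => ?_, fun v i hi => ?_⟩
  · by_cases hi : i = k
    · simp only [hi, if_true]; exact continuous_const
    · simp only [hi, if_false]; exact (continuous_apply i).comp hx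
  · ext i
    by_cases hi : i = k
    · simp [proj, L, hi]
    · have := congrFun (x.proj_lift u) i
      simpa [proj, L, hi] using this
  · exact if_pos rfl
  · exact if_neg hi

section RangeDecreasing

variable {f : MapGroup F →+ UnitAddTorus (Fin n)}

/-- Place `h` in both coordinates: `f` of the sum equals `f (single F j h)`, whose coordinate `k` is
zero. The realising point thus has `h ≡ 0` modulo `1`, and coordinate `j` carries the same function.
-/
theorem map_single_eq_zero_of_ne (hf : ∀ x : MapGroup F, f x ∈ Set.range x) {j k : Fin n}
    (hjk : j ≠ k) {h : smoothFunctions n} (hz : f (single F k h) = 0) :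
    f (single F j h) = 0 := by
  obtain ⟨v, hv⟩ := hf (single F j h + single F k h)
  rw [map_add, hz, add_zero, add_apply] at hv
  have h2 : f (single F j h) k = 0 := by
    obtain ⟨w, hw⟩ := hf (single F j h)
    rw [← hw, single_apply_of_ne hjk.symm]
  have h1 := congrFun hv k
  rw [h2, Pi.add_apply, single_apply_of_ne hjk.symm, zero_add, single_apply_same] at h1
  ext i
  by_cases hi : i = j
  · subst hi
    rw [← congrFun hv i, Pi.add_apply, single_apply_same, single_apply_of_ne hjk, h1, add_zero]
    rfl
  · obtain ⟨w, hw⟩ := hf (single F j h)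
    rw [← hw, single_apply_of_ne hi]
    rfl

/-- A range decreasing homomorphism kills `(g - a)²` for some value `a` of `g`. -/
theorem exists_map_single_sqSub_eq_zero (hf : ∀ x : MapGroup F, f x ∈ Set.range x) {j k : Fin n}
    (hjk : j ≠ k) (g : smoothFunctions n) (hg : ∀ v w, |g.1 v - g.1 w| < 1) :
    ∃ w, f (single F k (sqSub g (g.1 w))) = 0 := by
  obtain ⟨w, hw⟩ := hf (single F j g)
  refine ⟨w, ?_⟩
  obtain ⟨w', hw'⟩ := hf (single F k (sqSub g (g.1 w)))
  -- Additivity ties the values at `w` and `w'` to one common point `v`: coordinate `j` gives `g v =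
  -- g w`, so the square vanishes at `v`, and coordinate `k` transfers this to `w'`.
  obtain ⟨v, hv⟩ := hf (single F j g + single F k (sqSub g (g.1 w)))
  rw [map_add, ← hw, ← hw', add_apply] at hv
  have h1 := congrFun hv j
  simp only [Pi.add_apply, single_apply_same, single_apply_of_ne hjk, add_zero] at h1
  have h2 := congrFun hv k
  simp only [Pi.add_apply, single_apply_same, single_apply_of_ne hjk.symm, zero_add] at h2
  have h3 : (sqSub g (g.1 w)).1 v = 0 := by
    rw [sqSub_apply, eq_of_coe_eq_of_abs_sub_lt h1 (hg v w), sub_self, sq, zero_mul]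
  rw [← hw', ← single_apply_eq_zero (F := F) k h3]
  ext i
  by_cases hi : i = k
  · subst hi
    rw [single_apply_same, single_apply_same, h2]
  · rw [single_apply_of_ne hi, single_apply_of_ne hi]

/-- A range decreasing homomorphism kills a function with a single zero. -/
theorem exists_map_single_eq_zero (hf : ∀ x : MapGroup F, f x ∈ Set.range x) (hn : 2 ≤ n) :
    ∃ (v₀ : UnitAddTorus (Fin n)) (h : smoothFunctions n), h.1 v₀ = 0 ∧
      (∀ v, (h.1 v : UnitAddCircle) = 0 → v = v₀) ∧ ∀ k, f (single F k h) = 0 := by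
  have hn' : (0 : ℝ) < n := by exact_mod_cast (by lia : 0 < n)
  have hn1 : (1 : ℝ) ≤ n := by exact_mod_cast (by lia : 1 ≤ n)
  have : Nontrivial (Fin n) := Fin.nontrivial_iff_two_le.2 hn
  obtain ⟨j, k, hjk⟩ := exists_pair_ne (Fin n)
  -- The scale `c = 1 / (4 n)` bounds each oscillation by `2 c ≤ 1 / 2` and the sum of the `2 n`
  -- squares by `8 c² n = 2 c ≤ 1 / 2`. Hence congruences modulo `1` become equalities of real
  -- numbers.
  obtain ⟨c, hc0, hc4⟩ : ∃ c : ℝ, 0 < c ∧ c * n = 1 / 4 :=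
    ⟨1 / (4 * n), by positivity, by field_simp⟩
  have hc1 : c ≤ 1 / 4 := by nlinarith
  have habs : ∀ {a b : ℝ}, |a| ≤ c → |b| ≤ c → |a - b| ≤ 2 * c := by
    intro a b ha hb
    rw [abs_le] at *
    constructor <;> linarith
  have hcos : ∀ (i : Fin n) v w, |(cosCoord c i).1 v - (cosCoord c i).1 w| ≤ 2 * c :=
    fun i v w => habs (abs_cosCoord_le hc0.le i v) (abs_cosCoord_le hc0.le i w)
  have hsin : ∀ (i : Fin n) v w, |(sinCoord c i).1 v - (sinCoord c i).1 w| ≤ 2 * c :=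
    fun i v w => habs (abs_sinCoord_le hc0.le i v) (abs_sinCoord_le hc0.le i w)
  choose p hp using fun i => exists_map_single_sqSub_eq_zero hf hjk (cosCoord c i)
    fun v w => (hcos i v w).trans_lt (by linarith)
  choose q hq using fun i => exists_map_single_sqSub_eq_zero hf hjk (sinCoord c i)
    fun v w => (hsin i v w).trans_lt (by linarith)
  let h : smoothFunctions n := ∑ i, (sqSub (cosCoord c i) ((cosCoord c i).1 (p i)) +
    sqSub (sinCoord c i) ((sinCoord c i).1 (q i)))
  have hval : ∀ v, h.1 v = ∑ i, (((cosCoord c i).1 v - (cosCoord c i).1 (p i)) ^ 2 +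
      ((sinCoord c i).1 v - (sinCoord c i).1 (q i)) ^ 2) := fun v => by
    simp only [h, AddSubmonoidClass.coe_finsetSum, ContinuousMap.sum_apply]
    rfl
  have hlt : ∀ v, h.1 v < 1 := fun v => by
    rw [hval]
    calc _ ≤ ∑ _i : Fin n, ((2 * c) ^ 2 + (2 * c) ^ 2) := by
          refine Finset.sum_le_sum fun i _ => add_le_add ?_ ?_
          · exact sq_le_sq' (neg_le_of_abs_le (hcos i v _)) (le_of_abs_le (hcos i v _))
          · exact sq_le_sq' (neg_le_of_abs_le (hsin i v _)) (le_of_abs_le (hsin i v _))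
      _ = 8 * c * (c * n) := by simp; ring
      _ < 1 := by rw [hc4]; linarith
  have hnn : ∀ v, 0 ≤ h.1 v := fun v => by
    rw [hval]
    positivity
  have hcirc : ∀ v, (h.1 v : UnitAddCircle) = 0 → h.1 v = 0 := fun v hv =>
    eq_of_coe_eq_of_abs_sub_lt (by simpa using hv)
      (by rw [sub_zero, abs_of_nonneg (hnn v)]; exact hlt v)
  have hzero : ∀ v, h.1 v = 0 → ∀ i, (cosCoord c i).1 v = (cosCoord c i).1 (p i) ∧
      (sinCoord c i).1 v = (sinCoord c i).1 (q i) := by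
    intro v hv i
    rw [hval, Finset.sum_eq_zero_iff_of_nonneg fun i _ => by positivity] at hv
    have := hv i (Finset.mem_univ i)
    constructor <;> nlinarith [sq_nonneg ((cosCoord c i).1 v - (cosCoord c i).1 (p i)),
      sq_nonneg ((sinCoord c i).1 v - (sinCoord c i).1 (q i))]
  have hk : f (single F k h) = 0 := by
    simp only [h, map_sum, map_add, hp, hq, add_zero, Finset.sum_const_zero]
  -- The points `p i` and `q i` need not agree, so a zero of `h` is not evident; it exists because
  -- `0 = f (single F k h)` must be a value of `single F k h`.
  obtain ⟨v₀, hv₀⟩ := hf (single F k h)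
  have h0 : h.1 v₀ = 0 := hcirc v₀ (by
    rw [← single_apply_same (F := F) k h, hv₀, hk]; rfl)
  have huniq : ∀ v, (h.1 v : UnitAddCircle) = 0 → v = v₀ := fun v hv =>
    eq_of_cosCoord_eq_of_sinCoord_eq hc0.ne'
      (fun i => (hzero v (hcirc v hv) i).1.trans (hzero v₀ h0 i).1.symm)
      (fun i => (hzero v (hcirc v hv) i).2.trans (hzero v₀ h0 i).2.symm)
  refine ⟨v₀, h, h0, huniq, fun i => ?_⟩
  by_cases hi : i = k
  · rw [hi, hk]
  · exact map_single_eq_zero_of_ne hf hi hk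

/-- Adding `single F k h` does not change `f x`, whose coordinate `k` is zero. So `h` vanishes
modulo `1` at the point realising the value of the sum; that point is `v₀`, where the added term is
zero. -/
theorem map_eq_of_coord_eq_zero (hf : ∀ x : MapGroup F, f x ∈ Set.range x)
    {v₀ : UnitAddTorus (Fin n)} {h : smoothFunctions n} (h0 : h.1 v₀ = 0)
    (huniq : ∀ v, (h.1 v : UnitAddCircle) = 0 → v = v₀) (k : Fin n)
    (hk : f (single F k h) = 0) (x : MapGroup F) (hx : ∀ v, x v k = 0) : f x = x v₀ := by
  obtain ⟨v, hv⟩ := hf (x + single F k h)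
  obtain ⟨w, hw⟩ := hf x
  rw [map_add, hk, add_zero, add_apply] at hv
  have h1 := congrFun hv k
  rw [← hw, Pi.add_apply, hx, hx, zero_add, single_apply_same] at h1
  obtain rfl := huniq v h1
  rw [← hv, single_apply_eq_zero k h0, add_zero]

theorem exists_forall_map_eq_apply (hf : ∀ x : MapGroup F, f x ∈ Set.range x) (hn : 2 ≤ n) :
    ∃ v₀, ∀ x, f x = x v₀ := by
  obtain ⟨v₀, h, h0, huniq, hz⟩ := exists_map_single_eq_zero hf hn
  refine ⟨v₀, fun x => ?_⟩
  have : Nontrivial (Fin n) := Fin.nontrivial_iff_two_le.2 hn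
  obtain ⟨j, k, hjk⟩ := exists_pair_ne (Fin n)
  -- In `x = (x - y) + y`, coordinate `k` of `y` is zero, and `x - y` lives in coordinate `k` alone,
  -- so its coordinate `j` is zero.
  obtain ⟨y, hyk, hy⟩ := x.exists_eraseCoord k
  have h1 := map_eq_of_coord_eq_zero hf h0 huniq k (hz k) y hyk
  have h2 := map_eq_of_coord_eq_zero hf h0 huniq j (hz j) (x - y)
    fun v => by rw [sub_apply, Pi.sub_apply, hy v j hjk, sub_self]
  rw [← sub_add_cancel x y, map_add, h1, h2, add_apply]

end RangeDecreasing

end MapGroup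

end TorusMaps

theorem theorem2p3 (n : ℕ) (hn : 2 ≤ n) (F : TorusMaps.SmoothnessClass n) :
    Nonempty (TorusMaps.Pi0 F ≃+ Matrix (Fin n) (Fin n) ℤ) ∧
    AddSubgroup.closure {c : TorusMaps.Pi0 F | ∃ x₀ : TorusMaps.MapGroup F,
      Set.range x₀ ≠ Set.univ ∧ c = QuotientAddGroup.mk x₀} = ⊤ ∧
    ∀ f : TorusMaps.MapGroup F →+ UnitAddTorus (Fin n),
      (∀ x : TorusMaps.MapGroup F, f x ∈ Set.range x) →
        ∃ v₀ : UnitAddTorus (Fin n), ∀ x : TorusMaps.MapGroup F, f x = x v₀ :=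
  ⟨⟨TorusMaps.MapGroup.pi0Equiv F⟩, TorusMaps.MapGroup.closure_range_ne_univ_eq_top F hn,
    fun _ hf => TorusMaps.MapGroup.exists_forall_map_eq_apply hf hn⟩
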